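/- There are universal constants $C,c>0$ such that the following holds. Let $\mathbb K\in\{\mathbb R,\mathbb C\}$ and let $0\neq A\in\mathbb K^{m\times n}$ have stable rank $r:=\|A\|_F^2/\|A\|_2^2$, where $\|\cdot\|_F$ is the Frobenius norm and $\|\cdot\|_2$ is the spectral norm (and the Euclidean norm of vectors). Let $q_i^{\mathrm{row}}:=\|A(i,:)\|_2^2/\|A\|_F^2$, where $A(i,:)$ is the $i$-th row of $A$, and let $\widetilde q$ be a probability distribution on $\{1,\dots,m\}$ such that $\widetilde q_i\ge\alpha_i^2q_i^{\mathrm{row}}$ for all $i$, for some constants $\alpha_i>0$ (with the convention that $\alpha_i=1$ if $A(i,:)=0$). Let $\alpha:=\min_i\alpha_i$, let $\delta\in(0,1)$, and let $$0<\varepsilon<\min\bigl\{\delta^{-1/4}\sqrt{2\alpha},\ \sqrt2\bigr\}.$$ Let $d\in\{1,\dots,m\}$ satisfy $$d\ \ge\ C\,\frac{r}{\varepsilon^4\delta}\log\Bigl(\frac{r}{\varepsilon^4\delta}\Bigr).$$ Draw indices $i_1,\dots,i_d$ independently (with replacement) according to $\widetilde q$, and let $\hat R$ be the $d\times n$ matrix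 whose $j$-th row is the rescaled row $\frac{1}{\sqrt{d\,\widetilde q_{i_j}}}A(i_j,:)$. Then with probability at least $1-2\exp(-c\alpha^2/\delta)$, $$\|A^*A-\hat R^*\hat R\|_2\le\frac{\varepsilon^2}{2}\|A\|_2^2 .$$ -/

import Mathlib

open MeasureTheory ProbabilityTheory
open scoped Matrix Matrix.Norms.L2Operator

-- With this scope open, `‖A‖` for a matrix `A` is the spectral norm (the operator norm
-- between Euclidean spaces).

namespace RowSampling

variable {𝕜 : Type*} [RCLike 𝕜] {m n d : ℕ}

/-- The squared Euclidean length of the `i`-th row of `A`. -/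
noncomputable def rowNormSq (A : Matrix (Fin m) (Fin n) 𝕜) (i : Fin m) : ℝ :=
  ∑ j, ‖A i j‖ ^ 2

/-- The squared Frobenius norm of `A`. -/
noncomputable def frobeniusSq (A : Matrix (Fin m) (Fin n) 𝕜) : ℝ :=
  ∑ i, ∑ j, ‖A i j‖ ^ 2

/-- The stable rank: squared Frobenius norm over squared spectral norm (for `A ≠ 0`). -/
noncomputable def stableRank (A : Matrix (Fin m) (Fin n) 𝕜) : ℝ :=
  frobeniusSq A / ‖A‖ ^ 2

/-- The row-length probabilities `‖A(i,:)‖₂² / ‖A‖_F²` (for `A ≠ 0`). -/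
noncomputable def rowLengthProb (A : Matrix (Fin m) (Fin n) 𝕜) (i : Fin m) : ℝ :=
  rowNormSq A i / frobeniusSq A

/-- `q` is a probability distribution on the row indices. -/
def IsProbVector (q : Fin m → ℝ) : Prop :=
  (∀ i, 0 ≤ q i) ∧ ∑ i, q i = 1

/-- The matrix whose `j`-th row is the row of `A` with index `s j`, divided by `√(d q_{s j})`. -/
noncomputable def rescaledRows (A : Matrix (Fin m) (Fin n) 𝕜) (q : Fin m → ℝ)
    (s : Fin d → Fin m) : Matrix (Fin d) (Fin n) 𝕜 :=
  Matrix.of fun j k => (((√((d : ℝ) * q (s j)))⁻¹ : ℝ) : 𝕜) * A (s j) k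

/-- The random indices `s 0, …, s (d-1)` are drawn independently (with replacement), each with
distribution `q`. -/
structure IsIIDSample {Ω : Type*} [MeasurableSpace Ω] (P : Measure Ω) (q : Fin m → ℝ)
    (s : Fin d → Ω → Fin m) : Prop where
  measurable : ∀ j, Measurable (s j)
  indep : iIndepFun s P
  law : ∀ j i, P.real (s j ⁻¹' {i}) = q i

end RowSampling

namespace RowSampling

open Filter Topology
open scoped MatrixOrder ComplexOrder

section TraceInequalities

variable {𝕜 ι : Type*} [RCLike 𝕜] [Fintype ι]

/-- The real part of the trace. -/
noncomputable def reTrace : Matrix ι ι 𝕜 →ₗ[ℝ] ℝ :=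
  RCLike.reLm ∘ₗ (Matrix.traceLinearMap ι ℝ 𝕜)

lemma reTrace_apply (A : Matrix ι ι 𝕜) : reTrace A = RCLike.re A.trace := rfl

lemma reTrace_mul_comm (A B : Matrix ι ι 𝕜) : reTrace (A * B) = reTrace (B * A) := by
  rw [reTrace_apply, reTrace_apply, Matrix.trace_mul_comm]

lemma reTrace_conjTranspose (A : Matrix ι ι 𝕜) : reTrace Aᴴ = reTrace A := by
  simp [reTrace_apply, Matrix.trace_conjTranspose]

lemma reTrace_mul_pow_comm [DecidableEq ι] (A B : Matrix ι ι 𝕜) (k : ℕ) :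
    reTrace ((A * B) ^ k) = reTrace ((B * A) ^ k) := by
  rcases k with _ | k
  · simp
  · have h : (A * B) ^ k * A = A * (B * A) ^ k :=
      (SemiconjBy.pow_right (show SemiconjBy A (B * A) (A * B) by
        simp [SemiconjBy, mul_assoc]) k).symm
    rw [pow_succ, ← mul_assoc, h, mul_assoc, reTrace_mul_comm, mul_assoc, pow_succ]

lemma reTrace_nonneg {A : Matrix ι ι 𝕜} (hA : A.PosSemidef) : 0 ≤ reTrace A :=
  (RCLike.nonneg_iff.mp hA.trace_nonneg).1

variable [DecidableEq ι]

lemma reTrace_sq_le (X : Matrix ι ι 𝕜) : reTrace (X ^ 2) ≤ reTrace (Xᴴ * X) := by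
  have h := reTrace_nonneg (Matrix.posSemidef_conjTranspose_mul_self (X - Xᴴ))
  have e : (X - Xᴴ)ᴴ * (X - Xᴴ) = Xᴴ * X - (X ^ 2)ᴴ - X ^ 2 + X * Xᴴ := by
    rw [Matrix.conjTranspose_sub, Matrix.conjTranspose_conjTranspose, Matrix.conjTranspose_pow]
    noncomm_ring
  rw [e, map_add, map_sub, map_sub, reTrace_conjTranspose, reTrace_mul_comm X] at h
  linarith

lemma reTrace_mul_le {P Q : Matrix ι ι 𝕜} (hP : P.IsHermitian) (hQ : Q.IsHermitian) :
    reTrace (P * Q) ≤ (reTrace (P ^ 2) + reTrace (Q ^ 2)) / 2 := by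
  have h := reTrace_nonneg (Matrix.posSemidef_conjTranspose_mul_self (P - Q))
  have e : (P - Q)ᴴ * (P - Q) = P ^ 2 - P * Q - Q * P + Q ^ 2 := by
    rw [Matrix.conjTranspose_sub, hP.eq, hQ.eq]
    noncomm_ring
  rw [e, map_add, map_sub, map_sub, reTrace_mul_comm Q] at h
  linarith

lemma reTrace_two_pow_le (k : ℕ) :
    (∀ X : Matrix ι ι 𝕜, reTrace (X ^ 2 ^ (k + 1)) ≤ reTrace ((Xᴴ * X) ^ 2 ^ k)) ∧
    (∀ P Q : Matrix ι ι 𝕜, P.IsHermitian → Q.IsHermitian →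
      reTrace ((P * Q) ^ 2 ^ k) ≤ reTrace (P ^ 2 ^ k * Q ^ 2 ^ k)) := by
  induction k with
  | zero => exact ⟨fun X => by simpa using reTrace_sq_le X, fun P Q _ _ => by simp⟩
  | succ k ih =>
    obtain ⟨ihC, ihE⟩ := ih
    refine ⟨fun X => ?_, fun P Q hP hQ => ?_⟩
    · have hP : (Xᴴ * X).IsHermitian := Matrix.isHermitian_conjTranspose_mul_self X
      have hQ : (X * Xᴴ).IsHermitian := Matrix.isHermitian_mul_conjTranspose_self X
      calc reTrace (X ^ 2 ^ (k + 1 + 1)) = reTrace ((X ^ 2) ^ 2 ^ (k + 1)) := by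
            rw [← pow_mul, ← pow_succ']
        _ ≤ reTrace (((X ^ 2)ᴴ * X ^ 2) ^ 2 ^ k) := ihC _
        _ = reTrace ((Xᴴ * X * (X * Xᴴ)) ^ 2 ^ k) := by
            rw [show (X ^ 2)ᴴ * X ^ 2 = Xᴴ * (Xᴴ * X * X) by
              rw [Matrix.conjTranspose_pow]; noncomm_ring, reTrace_mul_pow_comm]
            simp only [mul_assoc]
        _ ≤ reTrace ((Xᴴ * X) ^ 2 ^ k * (X * Xᴴ) ^ 2 ^ k) := ihE _ _ hP hQ
        _ ≤ (reTrace (((Xᴴ * X) ^ 2 ^ k) ^ 2) + reTrace (((X * Xᴴ) ^ 2 ^ k) ^ 2)) / 2 :=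
            reTrace_mul_le (hP.pow _) (hQ.pow _)
        _ = reTrace ((Xᴴ * X) ^ 2 ^ (k + 1)) := by
            rw [← pow_mul, ← pow_mul, ← pow_succ, reTrace_mul_pow_comm X]
            ring
    · calc reTrace ((P * Q) ^ 2 ^ (k + 1)) ≤ reTrace (((P * Q)ᴴ * (P * Q)) ^ 2 ^ k) := ihC _
        _ = reTrace ((P ^ 2 * Q ^ 2) ^ 2 ^ k) := by
            rw [show (P * Q)ᴴ * (P * Q) = Q * (P * P * Q) by
              rw [Matrix.conjTranspose_mul, hP.eq, hQ.eq]; noncomm_ring, reTrace_mul_pow_comm]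
            simp only [mul_assoc, sq]
        _ ≤ reTrace ((P ^ 2) ^ 2 ^ k * (Q ^ 2) ^ 2 ^ k) := ihE _ _ (hP.pow _) (hQ.pow _)
        _ = _ := by rw [← pow_mul, ← pow_mul, ← pow_succ']

lemma reTrace_mul_nonneg {A B : Matrix ι ι 𝕜} (hA : A.PosSemidef) (hB : B.PosSemidef) :
    0 ≤ reTrace (A * B) := by
  obtain ⟨C, rfl⟩ := CStarAlgebra.nonneg_iff_eq_star_mul_self.mp (Matrix.nonneg_iff_posSemidef.mpr hB)
  rw [← mul_assoc, reTrace_mul_comm, ← mul_assoc]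
  exact reTrace_nonneg (hA.mul_mul_conjTranspose_same C)

end TraceInequalities

section LieTrotter

open NormedSpace

lemma norm_pow_sub_pow_le {𝔸 : Type*} [NormedRing 𝔸] [NormOneClass 𝔸] {X Y : 𝔸} {K : ℝ}
    (hX : ‖X‖ ≤ K) (hY : ‖Y‖ ≤ K) (hK : 1 ≤ K) (N : ℕ) :
    ‖X ^ N - Y ^ N‖ ≤ N * K ^ N * ‖X - Y‖ := by
  have hK0 : 0 ≤ K := zero_le_one.trans hK
  induction N with
  | zero => simp
  | succ N ih =>
    have e : X ^ (N + 1) - Y ^ (N + 1) = X ^ N * (X - Y) + (X ^ N - Y ^ N) * Y := by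
      rw [pow_succ, pow_succ]; noncomm_ring
    have hN : 0 ≤ K ^ N := pow_nonneg hK0 N
    calc ‖X ^ (N + 1) - Y ^ (N + 1)‖ ≤ ‖X ^ N‖ * ‖X - Y‖ + ‖X ^ N - Y ^ N‖ * ‖Y‖ := by
          rw [e]
          exact (norm_add_le _ _).trans (add_le_add (norm_mul_le _ _) (norm_mul_le _ _))
      _ ≤ K ^ (N + 1) * ‖X - Y‖ + (N * K ^ N * ‖X - Y‖) * K := by
          gcongr
          exact ((norm_pow_le X N).trans (pow_le_pow_left₀ (norm_nonneg _) hX N)).trans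
            (pow_le_pow_right₀ hK N.le_succ)
      _ = ((N + 1 : ℕ) : ℝ) * K ^ (N + 1) * ‖X - Y‖ := by push_cast; ring

variable {𝔸 : Type*} [NormedRing 𝔸] [NormOneClass 𝔸] [NormedAlgebra ℝ 𝔸]

lemma norm_exp_le (x : 𝔸) : ‖exp x‖ ≤ Real.exp ‖x‖ := by
  rw [Real.exp_eq_exp_ℝ, exp_eq_tsum ℝ, exp_eq_tsum ℝ]
  refine (norm_tsum_le_tsum_norm (norm_expSeries_summable' x)).trans ?_
  refine (norm_expSeries_summable' x).tsum_le_tsum (fun k => ?_) (expSeries_summable' _)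
  rw [norm_smul, smul_eq_mul, Real.norm_of_nonneg (by positivity)]
  gcongr
  exact norm_pow_le x k

variable [CompleteSpace 𝔸]

/-- The **Lie product formula**. -/
theorem tendsto_lie_product (A B : 𝔸) :
    Tendsto (fun N : ℕ => (exp ((N : ℝ)⁻¹ • A) * exp ((N : ℝ)⁻¹ • B)) ^ N) atTop
      (𝓝 (exp (A + B))) := by
  let F : ℝ → 𝔸 := fun t => exp (t • A) * exp (t • B) - exp (t • (A + B))
  have hF : HasDerivAt F 0 0 := by
    have := ((hasDerivAt_exp_smul_const A (0 : ℝ)).mul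
      (hasDerivAt_exp_smul_const B (0 : ℝ))).sub (hasDerivAt_exp_smul_const (A + B) (0 : ℝ))
    rw [show F = ((fun t : ℝ => exp (t • A)) * fun t => exp (t • B)) -
      fun t => exp (t • (A + B)) from rfl]
    convert! this using 1
    simp
  have hF0 : F 0 = 0 := by simp [F]
  have ho : Tendsto (fun N : ℕ => (N : ℝ) * ‖F (N : ℝ)⁻¹‖) atTop (𝓝 0) := by
    have h1 := hF.tendsto_slope_zero
    have h2 : Tendsto (fun N : ℕ => (N : ℝ)⁻¹) atTop (𝓝[≠] 0) :=
      tendsto_nhdsWithin_iff.mpr ⟨tendsto_inv_atTop_nhds_zero_nat,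
        (eventually_gt_atTop 0).mono fun N hN => by simp; omega⟩
    have h3 := (h1.comp h2).norm
    simpa [Function.comp_def, hF0, norm_smul] using h3
  rw [tendsto_iff_norm_sub_tendsto_zero]
  refine squeeze_zero' (Eventually.of_forall fun _ => norm_nonneg _) ?_
    (by simpa using ho.const_mul (Real.exp (‖A‖ + ‖B‖)))
  filter_upwards [eventually_gt_atTop 0] with N hN
  have hN' : (N : ℝ) ≠ 0 := by positivity
  have hN0 : (0 : ℝ) ≤ (N : ℝ)⁻¹ := by positivity
  have hns (x : 𝔸) : ‖(N : ℝ)⁻¹ • x‖ = (N : ℝ)⁻¹ * ‖x‖ := by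
    rw [norm_smul, Real.norm_of_nonneg hN0]
  let K := Real.exp ((N : ℝ)⁻¹ * (‖A‖ + ‖B‖))
  have hKN : K ^ N = Real.exp (‖A‖ + ‖B‖) := by
    rw [← Real.exp_nat_mul]; congr 1; field_simp
  have hX : ‖exp ((N : ℝ)⁻¹ • A) * exp ((N : ℝ)⁻¹ • B)‖ ≤ K := by
    refine (norm_mul_le _ _).trans ?_
    refine (mul_le_mul (norm_exp_le _) (norm_exp_le _) (norm_nonneg _) (Real.exp_nonneg _)).trans ?_
    rw [← Real.exp_add, hns, hns, ← mul_add]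
  have hY : ‖exp ((N : ℝ)⁻¹ • (A + B))‖ ≤ K := by
    refine (norm_exp_le _).trans (Real.exp_le_exp.mpr ?_)
    rw [hns]
    gcongr
    exact norm_add_le _ _
  have hYN : exp ((N : ℝ)⁻¹ • (A + B)) ^ N = exp (A + B) := by
    let : NormedAlgebra ℚ 𝔸 := .restrictScalars ℚ ℝ 𝔸
    rw [← exp_nsmul, ← Nat.cast_smul_eq_nsmul ℝ, smul_smul, mul_inv_cancel₀ hN', one_smul]
  have := norm_pow_sub_pow_le hX hY (Real.one_le_exp (by positivity)) N
  rw [hYN, hKN] at this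
  refine this.trans (le_of_eq ?_)
  simp only [F]
  ring

end LieTrotter

section GoldenThompson

open NormedSpace

variable {𝕜 ι : Type*} [RCLike 𝕜] [Fintype ι] [DecidableEq ι]

/-- The spectral norm makes matrices over `𝕜` a real normed algebra. -/
@[reducible]
noncomputable def matrixNormedAlgebraReal : NormedAlgebra ℝ (Matrix ι ι 𝕜) where
  norm_smul_le r x := by
    rw [← algebraMap_smul 𝕜 r x, norm_smul]
    simp

attribute [local instance] matrixNormedAlgebraReal

/-- The **Golden–Thompson inequality**. -/
theorem reTrace_exp_add_le [Nonempty ι] {A B : Matrix ι ι 𝕜} (hA : A.IsHermitian)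
    (hB : B.IsHermitian) : reTrace (exp (A + B)) ≤ reTrace (exp A * exp B) := by
  have hc : Continuous (reTrace : Matrix ι ι 𝕜 → ℝ) :=
    RCLike.continuous_re.comp (Continuous.matrix_trace continuous_id)
  have h := ((hc.tendsto _).comp (tendsto_lie_product A B)).comp
    (tendsto_pow_atTop_atTop_of_one_lt (one_lt_two : 1 < 2))
  refine le_of_tendsto h (Eventually.of_forall fun k => ?_)
  have hs (x : Matrix ι ι 𝕜) : exp (((2 ^ k : ℕ) : ℝ)⁻¹ • x) ^ 2 ^ k = exp x := by
    rw [← Matrix.exp_nsmul, ← Nat.cast_smul_eq_nsmul ℝ, smul_smul, mul_inv_cancel₀ (by positivity),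
      one_smul]
  have hh {x : Matrix ι ι 𝕜} (hx : x.IsHermitian) :
      (exp (((2 ^ k : ℕ) : ℝ)⁻¹ • x)).IsHermitian := by
    refine Matrix.IsHermitian.exp ?_
    rw [Matrix.IsHermitian, Matrix.conjTranspose_smul, hx.eq, star_trivial]
  have := (reTrace_two_pow_le k).2 _ _ (hh hA) (hh hB)
  rwa [hs, hs] at this

end GoldenThompson

attribute [local instance] matrixNormedAlgebraReal

section FunctionalCalculus

open NormedSpace

variable {𝕜 ι : Type*} [RCLike 𝕜] [Fintype ι] [DecidableEq ι]

lemma abs_le_norm_of_mem_spectrum [Nonempty ι] {A : Matrix ι ι 𝕜} (hA : A.IsHermitian) {x : ℝ}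
    (hx : x ∈ spectrum ℝ A) : |x| ≤ ‖A‖ :=
  (IsometricContinuousFunctionalCalculus.isGreatest_norm_spectrum (𝕜 := ℝ) A hA).2 ⟨x, hx, rfl⟩

lemma le_norm_smul_one [Nonempty ι] {A : Matrix ι ι 𝕜} (hA : A.IsHermitian) : A ≤ ‖A‖ • 1 := by
  rw [← Algebra.algebraMap_eq_smul_one]
  exact le_algebraMap_of_spectrum_le
    (fun x hx => (le_abs_self x).trans (abs_le_norm_of_mem_spectrum hA hx)) hA

lemma exp_le_one_add_add_sq [Nonempty ι] {Y : Matrix ι ι 𝕜} (hY : Y.IsHermitian)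
    (h : ‖Y‖ ≤ 1) : exp Y ≤ 1 + Y + Y ^ 2 := by
  have hY' : IsSelfAdjoint Y := hY
  have e : cfc (fun x : ℝ => 1 + x + x ^ 2) Y = 1 + Y + Y ^ 2 := by
    rw [cfc_add (hf := by fun_prop) (hg := by fun_prop), cfc_add (hf := by fun_prop)
      (hg := by fun_prop), cfc_pow_id Y 2, cfc_id' ℝ Y, cfc_const_one ℝ Y]
  rw [← e, ← CFC.real_exp_eq_normedSpace_exp hY']
  refine cfc_mono fun x hx => ?_
  have hx1 : ‖x‖ ≤ 1 := (abs_le_norm_of_mem_spectrum hY hx).trans h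
  have := (abs_le.mp (Real.norm_exp_sub_one_sub_id_le hx1)).2
  rw [Real.norm_eq_abs, sq_abs] at this
  linarith

lemma one_add_le_exp {S : Matrix ι ι 𝕜} (hS : S.IsHermitian) : 1 + S ≤ exp S := by
  have hS' : IsSelfAdjoint S := hS
  have e : cfc (fun x : ℝ => 1 + x) S = 1 + S := by
    rw [cfc_add (hf := by fun_prop) (hg := by fun_prop), cfc_id' ℝ S, cfc_const_one ℝ S]
  rw [← e, ← CFC.real_exp_eq_normedSpace_exp hS']
  exact cfc_mono fun x _ => by linarith [Real.add_one_le_exp x]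

lemma le_reTrace_of_mem_spectrum {G : Matrix ι ι 𝕜} (hG : G.PosSemidef) {x : ℝ}
    (hx : x ∈ spectrum ℝ G) : x ≤ reTrace G := by
  rw [hG.isHermitian.spectrum_real_eq_range_eigenvalues] at hx
  obtain ⟨i, rfl⟩ := hx
  rw [reTrace_apply, hG.isHermitian.trace_eq_sum_eigenvalues, map_sum]
  simp only [RCLike.ofReal_re]
  exact Finset.single_le_sum (fun j _ => hG.eigenvalues_nonneg j) (Finset.mem_univ i)

lemma exp_add_exp_neg_mono {s t : ℝ} (h : |s| ≤ |t|) :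
    Real.exp s + Real.exp (-s) ≤ Real.exp t + Real.exp (-t) := by
  have := Real.cosh_le_cosh.mpr h
  rw [Real.cosh_eq, Real.cosh_eq] at this
  linarith

lemma cfc_exp_add_exp_neg {S : Matrix ι ι 𝕜} (hS : S.IsHermitian) :
    cfc (fun x : ℝ => Real.exp x + Real.exp (-x) - 2) S = (exp S - 1) + (exp (-S) - 1) := by
  have hS' : IsSelfAdjoint S := hS
  have e2 : cfc (fun x : ℝ => Real.exp (-x)) S = exp (-S) := by
    rw [cfc_comp_neg Real.exp S, CFC.real_exp_eq_normedSpace_exp hS'.neg]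
  rw [cfc_sub (hf := by fun_prop) (hg := by fun_prop), cfc_add (hf := by fun_prop)
      (hg := by fun_prop), e2, CFC.real_exp_eq_normedSpace_exp hS', cfc_const (2 : ℝ) S, map_ofNat,
      ← one_add_one_eq_two]
  abel

lemma reTrace_exp_add_exp_neg_nonneg {S : Matrix ι ι 𝕜} (hS : S.IsHermitian) :
    0 ≤ reTrace (exp S - 1) + reTrace (exp (-S) - 1) := by
  rw [← map_add, ← cfc_exp_add_exp_neg hS]
  refine reTrace_nonneg (Matrix.nonneg_iff_posSemidef.mp (cfc_nonneg fun x _ => ?_))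
  linarith [exp_add_exp_neg_mono (s := 0) (t := x) (by simp), Real.exp_zero,
    show Real.exp (-0) = 1 by simp]

lemma exp_add_exp_neg_le_reTrace [Nonempty ι] {S : Matrix ι ι 𝕜} (hS : S.IsHermitian) {t : ℝ}
    (ht : 0 ≤ t) (h : t ≤ ‖S‖) :
    Real.exp t + Real.exp (-t) - 2 ≤ reTrace (exp S - 1) + reTrace (exp (-S) - 1) := by
  have hS' : IsSelfAdjoint S := hS
  obtain ⟨x, hx, hxS⟩ := (IsometricContinuousFunctionalCalculus.isGreatest_norm_spectrum (𝕜 := ℝ) S hS').1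
  have hG : (cfc (fun x : ℝ => Real.exp x + Real.exp (-x) - 2) S).PosSemidef := by
    refine Matrix.nonneg_iff_posSemidef.mp (cfc_nonneg fun x _ => ?_)
    linarith [exp_add_exp_neg_mono (s := 0) (t := x) (by simp), Real.exp_zero,
      show Real.exp (-0) = 1 by simp]
  have hmem : Real.exp x + Real.exp (-x) - 2 ∈
      spectrum ℝ (cfc (fun x : ℝ => Real.exp x + Real.exp (-x) - 2) S) := by
    rw [cfc_map_spectrum (fun x : ℝ => Real.exp x + Real.exp (-x) - 2) S hS' (by fun_prop)]
    exact ⟨x, hx, rfl⟩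
  rw [← map_add, ← cfc_exp_add_exp_neg hS]
  refine le_trans ?_ (le_reTrace_of_mem_spectrum hG hmem)
  have hxS' : |x| = ‖S‖ := hxS
  linarith [exp_add_exp_neg_mono (s := t) (t := x) (by rw [hxS', abs_of_nonneg ht]; exact h)]

end FunctionalCalculus

section Bernstein

open NormedSpace

variable {𝕜 ι κ : Type*} [RCLike 𝕜] [Fintype ι] [DecidableEq ι] [Fintype κ]

lemma sum_fin_succ_fun {M : Type*} [AddCommMonoid M] {d : ℕ} (F : (Fin (d + 1) → κ) → M) :
    ∑ f, F f = ∑ i, ∑ f : Fin d → κ, F (Fin.cons i f) := by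
  rw [← Fintype.sum_prod_type' (f := fun i (f : Fin d → κ) => F (Fin.cons i f))]
  exact (Fintype.sum_equiv (Fin.consEquiv fun _ => κ) _ _ fun x => rfl).symm

/-- The matrix moment generating function of a sum of `d` independent copies of the random matrix
taking the value `X i` with probability `q i`. -/
noncomputable def matrixMGF (q : κ → ℝ) (X : κ → Matrix ι ι 𝕜) (d : ℕ) : Matrix ι ι 𝕜 :=
  ∑ f : Fin d → κ, (∏ j, q (f j)) • exp (∑ j, X (f j))

variable {q : κ → ℝ} {X : κ → Matrix ι ι 𝕜}

omit [Fintype κ] [Fintype ι] [DecidableEq ι] in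
lemma isHermitian_sum_comp (hX : ∀ i, (X i).IsHermitian) {d : ℕ} (f : Fin d → κ) :
    (∑ j, X (f j)).IsHermitian := by
  rw [Matrix.IsHermitian, Matrix.conjTranspose_sum]
  exact Finset.sum_congr rfl fun j _ => hX _

omit [Fintype κ] in
lemma posSemidef_exp_sum_comp (hX : ∀ i, (X i).IsHermitian) {d : ℕ} (f : Fin d → κ) :
    (exp (∑ j, X (f j))).PosSemidef :=
  Matrix.nonneg_iff_posSemidef.mp
    (IsSelfAdjoint.exp_nonneg (show IsSelfAdjoint _ from isHermitian_sum_comp hX f))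

lemma sum_prod_eq_one (hq : ∑ i, q i = 1) (d : ℕ) :
    ∑ f : Fin d → κ, ∏ j, q (f j) = 1 := by
  induction d with
  | zero => simp
  | succ d ih =>
    rw [sum_fin_succ_fun]
    simp [Fin.prod_univ_succ, ← Finset.mul_sum, ih, hq]

omit [DecidableEq ι] [Fintype ι] in
lemma sum_prod_smul_sum_eq_zero (hq : ∑ i, q i = 1) (h0 : ∑ i, q i • X i = 0) (d : ℕ) :
    ∑ f : Fin d → κ, (∏ j, q (f j)) • ∑ j, X (f j) = 0 := by
  induction d with
  | zero => simp
  | succ d ih =>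
    rw [sum_fin_succ_fun]
    simp only [Fin.prod_univ_succ, Fin.sum_univ_succ, Fin.cons_zero, Fin.cons_succ, smul_add,
      Finset.sum_add_distrib, mul_smul, ← Finset.smul_sum, ih, smul_zero, add_zero]
    simp only [← Finset.sum_smul, sum_prod_eq_one hq, one_smul, h0]

lemma posSemidef_matrixMGF (hq : ∀ i, 0 ≤ q i) (hX : ∀ i, (X i).IsHermitian) (d : ℕ) :
    (matrixMGF q X d).PosSemidef :=
  Matrix.posSemidef_sum _ fun f _ =>
    (posSemidef_exp_sum_comp hX f).smul (Finset.prod_nonneg fun _ _ => hq _)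

lemma posSemidef_matrixMGF_sub_one (hq : ∀ i, 0 ≤ q i) (hq1 : ∑ i, q i = 1)
    (hX : ∀ i, (X i).IsHermitian) (h0 : ∑ i, q i • X i = 0) (d : ℕ) :
    (matrixMGF q X d - 1).PosSemidef := by
  have e : matrixMGF q X d - 1 =
      ∑ f : Fin d → κ, (∏ j, q (f j)) • (exp (∑ j, X (f j)) - (1 + ∑ j, X (f j))) := by
    simp only [smul_sub, smul_add, Finset.sum_sub_distrib, Finset.sum_add_distrib,
      sum_prod_smul_sum_eq_zero hq1 h0, ← Finset.sum_smul, sum_prod_eq_one hq1, one_smul, add_zero]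
    rfl
  rw [e]
  exact Matrix.posSemidef_sum _ fun f _ =>
    Matrix.PosSemidef.smul (one_add_le_exp (isHermitian_sum_comp hX f))
      (Finset.prod_nonneg fun j _ => hq _)

lemma reTrace_matrixMGF_succ_le [Nonempty ι] (hq : ∀ i, 0 ≤ q i) (hX : ∀ i, (X i).IsHermitian)
    (d : ℕ) : reTrace (matrixMGF q X (d + 1)) ≤
      reTrace ((∑ i, q i • exp (X i)) * matrixMGF q X d) := by
  rw [matrixMGF, sum_fin_succ_fun, matrixMGF, Finset.sum_mul]
  simp only [Finset.mul_sum, map_sum]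
  refine Finset.sum_le_sum fun i _ => Finset.sum_le_sum fun f _ => ?_
  simp only [Fin.prod_univ_succ, Fin.sum_univ_succ, Fin.cons_zero, Fin.cons_succ]
  rw [smul_mul_smul_comm, map_smul, map_smul]
  exact smul_le_smul_of_nonneg_left (reTrace_exp_add_le (hX i) (isHermitian_sum_comp hX f))
    (mul_nonneg (hq i) (Finset.prod_nonneg fun j _ => hq _))

lemma sum_smul_exp_le [Nonempty ι] (hq : ∀ i, 0 ≤ q i) (hq1 : ∑ i, q i = 1)
    (hX : ∀ i, (X i).IsHermitian) (h0 : ∑ i, q i • X i = 0) (hX1 : ∀ i, ‖X i‖ ≤ 1)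
    {V : Matrix ι ι 𝕜} (hV : ∑ i, q i • X i ^ 2 ≤ V) : ∑ i, q i • exp (X i) ≤ 1 + V := by
  calc ∑ i, q i • exp (X i) ≤ ∑ i, q i • (1 + X i + X i ^ 2) := by
        refine Finset.sum_le_sum fun i _ => ?_
        rw [Matrix.le_iff, ← smul_sub]
        exact Matrix.PosSemidef.smul (exp_le_one_add_add_sq (hX i) (hX1 i)) (hq i)
    _ = 1 + ∑ i, q i • X i ^ 2 := by
        simp only [smul_add, Finset.sum_add_distrib, h0, ← Finset.sum_smul, hq1, one_smul, add_zero]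
    _ ≤ 1 + V := by gcongr

lemma reTrace_matrixMGF_sub_one_le [Nonempty ι] (hq : ∀ i, 0 ≤ q i) (hq1 : ∑ i, q i = 1)
    (hX : ∀ i, (X i).IsHermitian) (h0 : ∑ i, q i • X i = 0) (hX1 : ∀ i, ‖X i‖ ≤ 1)
    {V : Matrix ι ι 𝕜} (hV : ∑ i, q i • X i ^ 2 ≤ V) {v r : ℝ} (hv : 0 ≤ v) (hr : 0 ≤ r)
    (hVv : V ≤ v • 1) (htr : reTrace V ≤ r * v) (d : ℕ) :
    reTrace (matrixMGF q X d - 1) ≤ r * Real.exp (d * v) := by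
  have key : reTrace (matrixMGF q X d - 1) ≤ r * ((1 + v) ^ d - 1) := by
    induction d with
    | zero => simp [matrixMGF]
    | succ d ih =>
      have h1 := reTrace_mul_nonneg (sum_smul_exp_le hq hq1 hX h0 hX1 hV)
        (posSemidef_matrixMGF hq hX d)
      have h2 := reTrace_mul_nonneg hVv (posSemidef_matrixMGF_sub_one hq hq1 hX h0 d)
      have h3 := reTrace_matrixMGF_succ_le hq hX d
      rw [sub_mul, map_sub, add_mul, one_mul, map_add] at h1
      rw [sub_mul, map_sub, smul_mul_assoc, one_mul, map_smul, smul_eq_mul, mul_sub, mul_one,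
        map_sub, map_sub] at h2
      rw [map_sub] at ih ⊢
      have h4 := mul_le_mul_of_nonneg_left ih (add_nonneg zero_le_one hv)
      rw [pow_succ]
      nlinarith
  refine key.trans (mul_le_mul_of_nonneg_left ?_ hr)
  have : (1 + v) ^ d ≤ Real.exp v ^ d := by
    gcongr
    linarith [Real.add_one_le_exp v]
  rw [Real.exp_nat_mul]
  linarith

/-- The **matrix Bernstein inequality** with intrinsic dimension `r`, for a sum of `d` independent
copies of a centred random matrix that takes finitely many values. -/
theorem sum_prod_filter_norm_le [Nonempty ι] (hq : ∀ i, 0 ≤ q i) (hq1 : ∑ i, q i = 1)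
    (hX : ∀ i, (X i).IsHermitian) (h0 : ∑ i, q i • X i = 0) (hX1 : ∀ i, ‖X i‖ ≤ 1)
    {V : Matrix ι ι 𝕜} (hV : ∑ i, q i • X i ^ 2 ≤ V) {v r : ℝ} (hv : 0 ≤ v) (hr : 0 ≤ r)
    (hVv : V ≤ v • 1) (htr : reTrace V ≤ r * v) (d : ℕ) {t : ℝ} (ht : 0 ≤ t) :
    (Real.exp t + Real.exp (-t) - 2) *
        ∑ f : Fin d → κ with t < ‖∑ j, X (f j)‖, ∏ j, q (f j) ≤
      2 * r * Real.exp (d * v) := by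
  have hneg := reTrace_matrixMGF_sub_one_le (X := fun i => -X i) hq hq1 (fun i => (hX i).neg)
    (by simp [h0]) (by simpa using hX1) (by simpa using hV) hv hr hVv htr d
  have hpos := reTrace_matrixMGF_sub_one_le hq hq1 hX h0 hX1 hV hv hr hVv htr d
  have e (Y : κ → Matrix ι ι 𝕜) : reTrace (matrixMGF q Y d - 1) =
      ∑ f : Fin d → κ, (∏ j, q (f j)) * reTrace (exp (∑ j, Y (f j)) - 1) := by
    simp only [matrixMGF, map_sub, map_sum, map_smul, smul_eq_mul, mul_sub, Finset.sum_sub_distrib,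
      ← Finset.sum_mul, sum_prod_eq_one hq1, one_mul]
  rw [e] at hneg hpos
  have hw (f : Fin d → κ) : 0 ≤ ∏ j, q (f j) := Finset.prod_nonneg fun j _ => hq _
  calc _ = ∑ f : Fin d → κ with t < ‖∑ j, X (f j)‖,
        (∏ j, q (f j)) * (Real.exp t + Real.exp (-t) - 2) := by
        rw [mul_comm, Finset.sum_mul]
    _ ≤ ∑ f : Fin d → κ with t < ‖∑ j, X (f j)‖, (∏ j, q (f j)) *
        (reTrace (exp (∑ j, X (f j)) - 1) + reTrace (exp (-∑ j, X (f j)) - 1)) := by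
        refine Finset.sum_le_sum fun f hf => mul_le_mul_of_nonneg_left ?_ (hw f)
        exact exp_add_exp_neg_le_reTrace (isHermitian_sum_comp hX f) ht
          (Finset.mem_filter.mp hf).2.le
    _ ≤ ∑ f : Fin d → κ, (∏ j, q (f j)) *
        (reTrace (exp (∑ j, X (f j)) - 1) + reTrace (exp (-∑ j, X (f j)) - 1)) :=
        Finset.sum_le_sum_of_subset_of_nonneg (Finset.filter_subset _ _) fun f _ _ =>
          mul_nonneg (hw f) (reTrace_exp_add_exp_neg_nonneg (isHermitian_sum_comp hX f))
    _ ≤ 2 * r * Real.exp (d * v) := by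
        simp only [mul_add, Finset.sum_add_distrib, ← Finset.sum_neg_distrib]
        linarith

end Bernstein

section RowGram

variable {𝕜 : Type*} [RCLike 𝕜] {m n d : ℕ}

/-- The rank-one matrix `A(i,:)* A(i,:)`. -/
noncomputable def rowGram (A : Matrix (Fin m) (Fin n) 𝕜) (i : Fin m) : Matrix (Fin n) (Fin n) 𝕜 :=
  Matrix.vecMulVec (star (A i)) (A i)

variable (A : Matrix (Fin m) (Fin n) 𝕜)

lemma rowNormSq_nonneg (i : Fin m) : 0 ≤ rowNormSq A i :=
  Finset.sum_nonneg fun _ _ => by positivity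

lemma sum_rowNormSq : ∑ i, rowNormSq A i = frobeniusSq A := rfl

lemma sum_rowGram : ∑ i, rowGram A i = Aᴴ * A := by
  ext k l
  simp [rowGram, Matrix.sum_apply, Matrix.vecMulVec_apply, Matrix.mul_apply]

lemma posSemidef_rowGram (i : Fin m) : (rowGram A i).PosSemidef :=
  Matrix.posSemidef_vecMulVec_star_self (A i)

lemma star_dotProduct_row (i : Fin m) : A i ⬝ᵥ star (A i) = (rowNormSq A i : 𝕜) := by
  simp [dotProduct, rowNormSq, RCLike.mul_conj]

lemma reTrace_rowGram (i : Fin m) : reTrace (rowGram A i) = rowNormSq A i := by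
  rw [reTrace_apply, rowGram, Matrix.trace_vecMulVec, dotProduct_comm, star_dotProduct_row,
    RCLike.ofReal_re]

lemma rowGram_sq (i : Fin m) : rowGram A i ^ 2 = rowNormSq A i • rowGram A i := by
  rw [sq, rowGram, Matrix.vecMulVec_mul_vecMulVec, star_dotProduct_row]
  ext k l
  simp [Matrix.vecMulVec_apply, RCLike.real_smul_eq_coe_mul]
  ring

lemma norm_rowGram_le (i : Fin m) : ‖rowGram A i‖ ≤ rowNormSq A i := by
  have h := Matrix.l2_opNorm_conjTranspose_mul_self (rowGram A i)
  rw [(posSemidef_rowGram A i).isHermitian.eq, ← sq, rowGram_sq, norm_smul,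
    Real.norm_of_nonneg (rowNormSq_nonneg A i)] at h
  by_contra! hc
  nlinarith [rowNormSq_nonneg A i]

lemma norm_sq_le_frobeniusSq : ‖A‖ ^ 2 ≤ frobeniusSq A := by
  rw [sq, ← Matrix.l2_opNorm_conjTranspose_mul_self, ← sum_rowGram, ← sum_rowNormSq]
  exact norm_sum_le_of_le _ fun i _ => norm_rowGram_le A i

lemma reTrace_conjTranspose_mul_self : reTrace (Aᴴ * A) = frobeniusSq A := by
  rw [← sum_rowGram, map_sum]
  exact Finset.sum_congr rfl fun i _ => reTrace_rowGram A i

lemma rescaledRows_conjTranspose_mul_self {q : Fin m → ℝ} (hq : ∀ i, 0 ≤ q i)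
    (s : Fin d → Fin m) : (rescaledRows A q s)ᴴ * rescaledRows A q s =
      (d : ℝ)⁻¹ • ∑ j, (q (s j))⁻¹ • rowGram A (s j) := by
  ext k l
  simp only [Matrix.mul_apply, rescaledRows, Matrix.conjTranspose_apply, Matrix.of_apply,
    Matrix.smul_apply, Matrix.sum_apply, rowGram, Matrix.vecMulVec_apply, Finset.smul_sum]
  refine Finset.sum_congr rfl fun j _ => ?_
  have h : (√((d : ℝ) * q (s j)))⁻¹ * (√((d : ℝ) * q (s j)))⁻¹ = (d : ℝ)⁻¹ * (q (s j))⁻¹ := by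
    rw [← mul_inv, Real.mul_self_sqrt (mul_nonneg d.cast_nonneg (hq _)), mul_inv]
  rw [smul_smul, ← h, RCLike.real_smul_eq_coe_mul, star_mul', RCLike.star_def, RCLike.conj_ofReal,
    RCLike.ofReal_mul, Pi.star_apply, RCLike.star_def]
  ring

variable {A} {q : Fin m → ℝ} {M : ℝ}

lemma rowGram_eq_zero (h : ∀ i, rowNormSq A i ≤ M * q i) {i : Fin m} (hi : q i = 0) :
    rowGram A i = 0 := by
  have := (norm_rowGram_le A i).trans (h i)
  rwa [hi, mul_zero, norm_le_zero_iff] at this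

lemma smul_inv_smul_rowGram (h : ∀ i, rowNormSq A i ≤ M * q i) (i : Fin m) :
    q i • (q i)⁻¹ • rowGram A i = rowGram A i := by
  by_cases hi : q i = 0
  · simp [rowGram_eq_zero h hi]
  · rw [smul_smul, mul_inv_cancel₀ hi, one_smul]

lemma inv_mul_rowNormSq_le (hq : ∀ i, 0 ≤ q i) (hM : 0 ≤ M)
    (h : ∀ i, rowNormSq A i ≤ M * q i) (i : Fin m) : (q i)⁻¹ * rowNormSq A i ≤ M := by
  rcases (hq i).eq_or_lt with hi | hi
  · simpa [← hi] using hM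
  · rw [inv_mul_le_iff₀ hi, mul_comm]
    exact h i

lemma norm_smul_rowGram_le (hq : ∀ i, 0 ≤ q i) (hM : 0 ≤ M)
    (h : ∀ i, rowNormSq A i ≤ M * q i) (i : Fin m) : ‖(q i)⁻¹ • rowGram A i‖ ≤ M := by
  rw [norm_smul, Real.norm_of_nonneg (inv_nonneg.mpr (hq i))]
  exact (mul_le_mul_of_nonneg_left (norm_rowGram_le A i) (inv_nonneg.mpr (hq i))).trans
    (inv_mul_rowNormSq_le hq hM h i)

lemma sum_smul_centred_eq_zero (hq1 : ∑ i, q i = 1) (h : ∀ i, rowNormSq A i ≤ M * q i) (θ : ℝ) :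
    ∑ i, q i • θ • ((q i)⁻¹ • rowGram A i - Aᴴ * A) = 0 := by
  simp only [smul_comm _ θ, ← Finset.smul_sum, smul_sub, Finset.sum_sub_distrib,
    smul_inv_smul_rowGram h, sum_rowGram, ← Finset.sum_smul, hq1, one_smul, sub_self]

lemma norm_centred_le (hq : ∀ i, 0 ≤ q i) (hM : 0 ≤ M) (h : ∀ i, rowNormSq A i ≤ M * q i)
    (hA : ‖A‖ ^ 2 ≤ M) {θ : ℝ} (hθ : 0 ≤ θ) (i : Fin m) :
    ‖θ • ((q i)⁻¹ • rowGram A i - Aᴴ * A)‖ ≤ θ * (2 * M) := by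
  rw [norm_smul, Real.norm_of_nonneg hθ]
  refine mul_le_mul_of_nonneg_left ((norm_sub_le _ _).trans ?_) hθ
  rw [Matrix.l2_opNorm_conjTranspose_mul_self, ← sq]
  linarith [norm_smul_rowGram_le hq hM h i]

lemma isHermitian_centred (θ : ℝ) (i : Fin m) :
    (θ • ((q i)⁻¹ • rowGram A i - Aᴴ * A)).IsHermitian := by
  rw [Matrix.IsHermitian, Matrix.conjTranspose_smul, Matrix.conjTranspose_sub,
    Matrix.conjTranspose_smul, (posSemidef_rowGram A i).isHermitian.eq,
    (Matrix.isHermitian_conjTranspose_mul_self A).eq, star_trivial, star_trivial]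

lemma sum_smul_centred_sq_le (hq : ∀ i, 0 ≤ q i) (hq1 : ∑ i, q i = 1) (hM : 0 ≤ M)
    (h : ∀ i, rowNormSq A i ≤ M * q i) (θ : ℝ) :
    ∑ i, q i • (θ • ((q i)⁻¹ • rowGram A i - Aᴴ * A)) ^ 2 ≤ (θ ^ 2 * M) • (Aᴴ * A) := by
  have hG : (Aᴴ * A).IsHermitian := Matrix.isHermitian_conjTranspose_mul_self A
  have e (i : Fin m) : q i • (θ • ((q i)⁻¹ • rowGram A i - Aᴴ * A)) ^ 2 =
      θ ^ 2 • (((q i)⁻¹ * rowNormSq A i) • rowGram A i - rowGram A i * (Aᴴ * A)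
        - (Aᴴ * A) * rowGram A i + q i • (Aᴴ * A) ^ 2) := by
    have e1 : ((q i)⁻¹ • rowGram A i - Aᴴ * A) ^ 2 = (q i)⁻¹ • (q i)⁻¹ • rowGram A i ^ 2
        - (q i)⁻¹ • (rowGram A i * (Aᴴ * A)) - (q i)⁻¹ • ((Aᴴ * A) * rowGram A i)
        + (Aᴴ * A) ^ 2 := by
      simp only [sq, sub_mul, mul_sub, smul_mul_assoc, mul_smul_comm, smul_sub]
      abel
    have e2 := smul_inv_smul_rowGram h i
    rw [smul_pow, smul_comm, e1, smul_add, smul_sub, smul_sub, rowGram_sq]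
    congr 3
    · congr 1
      · conv_rhs => rw [← e2]
        simp only [smul_smul]
        congr 1
        ring
      · conv_rhs => rw [← e2]
        simp only [smul_mul_assoc]
    · conv_rhs => rw [← e2]
      simp only [mul_smul_comm]
  have e' : ∑ i, q i • (θ • ((q i)⁻¹ • rowGram A i - Aᴴ * A)) ^ 2 =
      θ ^ 2 • (∑ i, ((q i)⁻¹ * rowNormSq A i) • rowGram A i - (Aᴴ * A) ^ 2) := by
    simp only [e, ← Finset.smul_sum, Finset.sum_add_distrib, Finset.sum_sub_distrib,
      ← Finset.sum_mul, ← Finset.mul_sum, ← Finset.sum_smul, hq1, sum_rowGram, one_smul]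
    congr 1
    noncomm_ring
  rw [e', mul_smul, Matrix.le_iff, ← smul_sub]
  refine Matrix.PosSemidef.smul ?_ (sq_nonneg θ)
  rw [← sum_rowGram A, Finset.smul_sum, ← sub_add, ← Finset.sum_sub_distrib, sum_rowGram]
  refine (Matrix.posSemidef_sum _ fun i _ => ?_).add ?_
  · rw [← sub_smul]
    exact (posSemidef_rowGram A i).smul (sub_nonneg.mpr (inv_mul_rowNormSq_le hq hM h i))
  · nth_rw 1 [sq, ← hG.eq]
    exact Matrix.posSemidef_conjTranspose_mul_self _

/-- Row sampling by independent draws: the probability, as a finite sum, that the sampled Gram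
matrix deviates from `A* A` by more than `ε² / 2 * ‖A‖²`. -/
lemma sum_prod_filter_norm_sub_le [NeZero n] (hA : A ≠ 0) (hq : ∀ i, 0 ≤ q i)
    (hq1 : ∑ i, q i = 1) (h : ∀ i, rowNormSq A i ≤ M * q i) (hAM : ‖A‖ ^ 2 ≤ M) {ε : ℝ}
    (hε : 0 < ε) (hε2 : ε ^ 2 ≤ 2) (hd : 1 ≤ d) :
    (Real.exp (2 * (d * ε ^ 4 * ‖A‖ ^ 2 / (16 * M))) +
      Real.exp (-(2 * (d * ε ^ 4 * ‖A‖ ^ 2 / (16 * M)))) - 2) *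
        ∑ f : Fin d → Fin m with
          ¬ ‖Aᴴ * A - (rescaledRows A q f)ᴴ * rescaledRows A q f‖ ≤ ε ^ 2 / 2 * ‖A‖ ^ 2,
          ∏ j, q (f j) ≤
      2 * stableRank A * Real.exp (d * ε ^ 4 * ‖A‖ ^ 2 / (16 * M)) := by
  have hA0 : 0 < ‖A‖ ^ 2 := by positivity
  have hM : 0 < M := hA0.trans_le hAM
  have hd0 : (0 : ℝ) < d := by exact_mod_cast hd
  set θ : ℝ := ε ^ 2 / (4 * M) with hθ
  have hθ0 : 0 < θ := by positivity
  have hVh : (Aᴴ * A).IsHermitian := Matrix.isHermitian_conjTranspose_mul_self A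
  have hnG : ‖Aᴴ * A‖ = ‖A‖ ^ 2 := by rw [Matrix.l2_opNorm_conjTranspose_mul_self, sq]
  have hVv : (θ ^ 2 * M) • (Aᴴ * A) ≤ (θ ^ 2 * M * ‖A‖ ^ 2) • (1 : Matrix (Fin n) (Fin n) 𝕜) := by
    rw [mul_smul _ (‖A‖ ^ 2), Matrix.le_iff, ← smul_sub, ← hnG]
    exact Matrix.PosSemidef.smul (le_norm_smul_one hVh) (by positivity)
  have hF : 0 ≤ frobeniusSq A := hA0.le.trans (norm_sq_le_frobeniusSq A)
  have htr : reTrace ((θ ^ 2 * M) • (Aᴴ * A)) ≤ stableRank A * (θ ^ 2 * M * ‖A‖ ^ 2) := by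
    rw [map_smul, reTrace_conjTranspose_mul_self, stableRank, smul_eq_mul]
    apply le_of_eq
    field_simp
  have key := sum_prod_filter_norm_le hq hq1 (isHermitian_centred θ)
    (sum_smul_centred_eq_zero hq1 h θ)
    (fun i => (norm_centred_le hq hM.le h hAM hθ0.le i).trans
      (by rw [hθ]; field_simp; linarith))
    (sum_smul_centred_sq_le hq hq1 hM.le h θ) (by positivity)
    (div_nonneg hF hA0.le) hVv htr d
    (t := 2 * (d * ε ^ 4 * ‖A‖ ^ 2 / (16 * M))) (by positivity)
  have ev : (d : ℝ) * (θ ^ 2 * M * ‖A‖ ^ 2) = d * ε ^ 4 * ‖A‖ ^ 2 / (16 * M) := by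
    rw [hθ]; field_simp; norm_num
  rw [ev] at key
  rw [← stableRank] at key
  convert key using 3
  refine Finset.filter_congr fun f _ => ?_
  have e : ∑ j, θ • ((q (f j))⁻¹ • rowGram A (f j) - Aᴴ * A) =
      -((θ * d) • (Aᴴ * A - (rescaledRows A q f)ᴴ * rescaledRows A q f)) := by
    rw [rescaledRows_conjTranspose_mul_self A hq, ← Finset.smul_sum, Finset.sum_sub_distrib,
      ← smul_neg, neg_sub, mul_smul, smul_sub (d : ℝ), smul_smul (d : ℝ), mul_inv_cancel₀ hd0.ne',
      one_smul]
    simp [← Nat.cast_smul_eq_nsmul ℝ]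
  rw [e, norm_neg, norm_smul, Real.norm_of_nonneg (by positivity), not_le,
    ← mul_lt_mul_iff_right₀ (show 0 < θ * d by positivity)]
  refine iff_of_eq (congrArg (· < _) ?_)
  rw [hθ]; field_simp; norm_num

end RowGram

section Probability

variable {m d : ℕ} {Ω : Type*} [MeasurableSpace Ω] {P : Measure Ω} {q : Fin m → ℝ}
  {s : Fin d → Ω → Fin m}

lemma IsIIDSample.measureReal_preimage_singleton (hs : IsIIDSample P q s)
    (f : Fin d → Fin m) : P.real {ω | (fun j => s j ω) = f} = ∏ j, q (f j) := by
  have h := hs.indep.measure_inter_preimage_eq_mul Finset.univ (sets := fun j => {f j})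
    fun j _ => measurableSet_singleton _
  have e : {ω | (fun j => s j ω) = f} = ⋂ j ∈ Finset.univ, s j ⁻¹' {f j} := by
    ext ω
    simp [funext_iff]
  rw [e, measureReal_def, h, ENNReal.toReal_prod]
  exact Finset.prod_congr rfl fun j _ => hs.law j (f j)

lemma IsIIDSample.measureReal_setOf [IsProbabilityMeasure P] (hs : IsIIDSample P q s)
    (p : (Fin d → Fin m) → Prop) [DecidablePred p] :
    P.real {ω | p fun j => s j ω} = ∑ f : Fin d → Fin m with p f, ∏ j, q (f j) := by
  have hm : Measurable fun ω j => s j ω := measurable_pi_lambda _ hs.measurable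
  have e : {ω | p fun j => s j ω} =
      ⋃ f ∈ Finset.univ.filter p, {ω | (fun j => s j ω) = f} := by
    ext ω
    simp
  rw [e, measureReal_biUnion_finset]
  · exact Finset.sum_congr rfl fun f _ => hs.measureReal_preimage_singleton f
  · intro f _ g _ hfg
    exact Set.disjoint_left.mpr fun ω hf hg => hfg (hf.symm.trans hg)
  · exact fun f _ => hm (measurableSet_singleton f)

end Probability

lemma le_two_mul_exp_of_bernstein {r α δ ε d p : ℝ} (hr : 1 ≤ r) (hα : 0 < α) (hα1 : α ≤ 1)
    (hδ : 0 < δ) (hε : 0 < ε) (hε2 : ε ^ 2 ≤ 2) (hp : 0 ≤ p) (hp1 : p ≤ 1)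
    (hd : 64 * (r / (ε ^ 4 * δ) * Real.log (r / (ε ^ 4 * δ))) ≤ d)
    (h : (Real.exp (2 * (d * ε ^ 4 * α ^ 2 / (16 * r))) +
      Real.exp (-(2 * (d * ε ^ 4 * α ^ 2 / (16 * r)))) - 2) * p ≤
        2 * r * Real.exp (d * ε ^ 4 * α ^ 2 / (16 * r))) :
    p ≤ 2 * Real.exp (-(1 / 30 * α ^ 2 / δ)) := by
  set x := α ^ 2 / δ with hx
  have hx0 : 0 < x := by positivity
  rw [mul_div_assoc, ← hx]
  have hr0 : 0 < r := zero_lt_one.trans_le hr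
  rcases le_or_gt x 15 with hx15 | hx15
  · linarith [Real.add_one_le_exp (-(1 / 30 * x))]
  set w := d * ε ^ 4 * α ^ 2 / (16 * r) with hw
  have hL : 1 + Real.log r ≤ Real.log (r / (ε ^ 4 * δ)) := by
    rw [Real.le_log_iff_exp_le (by positivity), Real.exp_add, Real.exp_log hr0,
      le_div_iff₀ (by positivity)]
    have h1 : δ ≤ 1 / 15 := by
      rw [hx, lt_div_iff₀ hδ] at hx15
      nlinarith
    have h2 : ε ^ 4 ≤ 4 := by nlinarith [sq_nonneg ε]
    have h3 : ε ^ 4 * δ ≤ 4 * (1 / 15) := by gcongr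
    have h4 := mul_le_mul Real.exp_one_lt_d9.le h3 (by positivity) (by norm_num)
    nlinarith
  have hlog : 0 ≤ Real.log r := Real.log_nonneg hr
  have hwL : 4 * x * Real.log (r / (ε ^ 4 * δ)) ≤ w := by
    calc 4 * x * Real.log (r / (ε ^ 4 * δ)) =
        64 * (r / (ε ^ 4 * δ) * Real.log (r / (ε ^ 4 * δ))) * (ε ^ 4 * α ^ 2 / (16 * r)) := by
          rw [hx]; field_simp; ring
      _ ≤ d * (ε ^ 4 * α ^ 2 / (16 * r)) := by gcongr
      _ = w := by rw [hw]; ring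
  have hwx : 4 * x * (1 + Real.log r) ≤ w :=
    (mul_le_mul_of_nonneg_left hL (by positivity)).trans hwL
  have hw2 : 2 + Real.log r + 1 / 30 * x ≤ w := by nlinarith
  have hE : 3 ≤ Real.exp w := by linarith [Real.add_one_le_exp w]
  have hE2 : Real.exp (2 * w) = Real.exp w * Real.exp w := by rw [← Real.exp_add]; ring_nf
  have hp4 : Real.exp w * p ≤ 4 * r := by
    have h5 : Real.exp w * (Real.exp w * p) ≤ Real.exp w * (4 * r) := by
      have h6 : Real.exp w * Real.exp w / 2 ≤
          Real.exp (2 * w) + Real.exp (-(2 * w)) - 2 := by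
        nlinarith [Real.exp_pos (-(2 * w))]
      linarith [mul_le_mul_of_nonneg_right h6 hp]
    exact le_of_mul_le_mul_left h5 (Real.exp_pos w)
  have h4r : 4 * r ≤ Real.exp (2 + Real.log r) := by
    have h9 : Real.exp 2 = Real.exp 1 * Real.exp 1 := by rw [← Real.exp_add]; norm_num
    rw [Real.exp_add, Real.exp_log hr0, h9]
    gcongr
    nlinarith [Real.add_one_le_exp (1 : ℝ)]
  have h7 : p ≤ Real.exp (2 + Real.log r - w) := by
    rw [Real.exp_sub, le_div_iff₀ (Real.exp_pos w), mul_comm]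
    exact hp4.trans h4r
  have h8 : Real.exp (2 + Real.log r - w) ≤ Real.exp (-(1 / 30 * x)) :=
    Real.exp_le_exp.mpr (by linarith)
  linarith [Real.exp_pos (-(1 / 30 * x))]

end RowSampling

theorem mainTheorem7 :
    ∃ C c : ℝ, 0 < C ∧ 0 < c ∧
      ∀ (𝕜 : Type*) [RCLike 𝕜] (m n : ℕ) (A : Matrix (Fin m) (Fin n) 𝕜), A ≠ 0 →
      ∀ (q a : Fin m → ℝ) (α δ ε : ℝ) (d : ℕ),
        RowSampling.IsProbVector q →
        (∀ i, 0 < a i) →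
        (∀ i, A i = 0 → a i = 1) →
        (∀ i, a i ^ 2 * RowSampling.rowLengthProb A i ≤ q i) →
        IsLeast (Set.range a) α →
        0 < δ → δ < 1 →
        0 < ε → ε < δ ^ (-(1 / 4) : ℝ) * √(2 * α) → ε < √2 →
        1 ≤ d → d ≤ m →
        C * (RowSampling.stableRank A / (ε ^ 4 * δ) *
          Real.log (RowSampling.stableRank A / (ε ^ 4 * δ))) ≤ (d : ℝ) →
      ∀ (Ω : Type*) [MeasurableSpace Ω] (P : Measure Ω) [IsProbabilityMeasure P]
        (s : Fin d → Ω → Fin m), RowSampling.IsIIDSample P q s →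
        1 - 2 * Real.exp (-(c * α ^ 2 / δ)) ≤
          P.real {ω | ‖Aᴴ * A - (RowSampling.rescaledRows A q (fun j => s j ω))ᴴ *
              RowSampling.rescaledRows A q (fun j => s j ω)‖ ≤ ε ^ 2 / 2 * ‖A‖ ^ 2} := by
  refine ⟨64, 1 / 30, by norm_num, by norm_num, ?_⟩
  intro 𝕜 _ m n A hA q a α δ ε d hq ha _ haq hα hδ _ hε _ hε2 hd _ hdC Ω _ P _ s hs
  have hn : NeZero n := ⟨fun hn => hA (by subst hn; ext i j; exact j.elim0)⟩
  have hA0 : 0 < ‖A‖ ^ 2 := by positivity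
  have hF : 0 < RowSampling.frobeniusSq A := hA0.trans_le (RowSampling.norm_sq_le_frobeniusSq A)
  have hα0 : 0 < α := by
    obtain ⟨i, rfl⟩ := hα.1
    exact ha i
  have hrow (i : Fin m) : α ^ 2 * RowSampling.rowLengthProb A i ≤ q i :=
    (mul_le_mul_of_nonneg_right (pow_le_pow_left₀ hα0.le (hα.2 ⟨i, rfl⟩) 2)
      (div_nonneg (RowSampling.rowNormSq_nonneg A i) hF.le)).trans (haq i)
  have hα1 : α ≤ 1 := by
    have h := Finset.sum_le_sum fun i (_ : i ∈ Finset.univ) => hrow i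
    rw [← Finset.mul_sum, hq.2] at h
    simp only [RowSampling.rowLengthProb] at h
    rw [← Finset.sum_div, RowSampling.sum_rowNormSq, div_self hF.ne', mul_one] at h
    exact (sq_le_one_iff₀ hα0.le).mp h
  have hM (i : Fin m) : RowSampling.rowNormSq A i ≤ RowSampling.frobeniusSq A / α ^ 2 * q i := by
    have h := hrow i
    rw [RowSampling.rowLengthProb] at h
    calc RowSampling.rowNormSq A i = RowSampling.frobeniusSq A / α ^ 2 *
          (α ^ 2 * (RowSampling.rowNormSq A i / RowSampling.frobeniusSq A)) := by field_simp
      _ ≤ _ := by gcongr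
  have hAM : ‖A‖ ^ 2 ≤ RowSampling.frobeniusSq A / α ^ 2 :=
    (RowSampling.norm_sq_le_frobeniusSq A).trans
      (le_div_self hF.le (by positivity) (pow_le_one₀ hα0.le hα1))
  have hε2' : ε ^ 2 ≤ 2 := by
    rw [← Real.sq_sqrt (zero_le_two : (0 : ℝ) ≤ 2)]
    gcongr
  have hB := RowSampling.sum_prod_filter_norm_sub_le hA hq.1 hq.2 hM hAM hε hε2' hd
  have hr : 1 ≤ RowSampling.stableRank A :=
    (one_le_div₀ hA0).mpr (RowSampling.norm_sq_le_frobeniusSq A)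
  rw [show (d : ℝ) * ε ^ 4 * ‖A‖ ^ 2 / (16 * (RowSampling.frobeniusSq A / α ^ 2)) =
      d * ε ^ 4 * α ^ 2 / (16 * RowSampling.stableRank A) by
    rw [RowSampling.stableRank]; field_simp] at hB
  have hbad := hs.measureReal_setOf fun f => ¬ ‖Aᴴ * A - (RowSampling.rescaledRows A q f)ᴴ *
    RowSampling.rescaledRows A q f‖ ≤ ε ^ 2 / 2 * ‖A‖ ^ 2
  rw [← hbad] at hB
  have hfin := RowSampling.le_two_mul_exp_of_bernstein hr hα0 hα1 hδ hε hε2' measureReal_nonneg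
    measureReal_le_one hdC hB
  have hunion := measureReal_union_le (μ := P)
    {ω | ‖Aᴴ * A - (RowSampling.rescaledRows A q (fun j => s j ω))ᴴ *
      RowSampling.rescaledRows A q (fun j => s j ω)‖ ≤ ε ^ 2 / 2 * ‖A‖ ^ 2}
    {ω | ¬ ‖Aᴴ * A - (RowSampling.rescaledRows A q (fun j => s j ω))ᴴ *
      RowSampling.rescaledRows A q (fun j => s j ω)‖ ≤ ε ^ 2 / 2 * ‖A‖ ^ 2}
  rw [← Set.ofPred_or] at hunion
  simp only [em, Set.ofPred_true, probReal_univ] at hunion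
  linarith
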